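/- For a positive integer $n$, an $n$-sided die is a sequence $A=(a_1,\dots,a_n)$ of elements of $[n]=\{1,\dots,n\}$ with $\sum_i a_i=n(n+1)/2$, and a random $n$-sided die is one chosen uniformly among all such sequences. For such $A$ and $j\in[n]$ put $$f_A(j)=|\{i:a_i<j\}|+\tfrac12|\{i:a_i=j\}|,\qquad g_A(j)=f_A(j)-j+\tfrac12,$$ and for real $\alpha,\beta$ let $$\hat f(\alpha,\beta)=\mathbb{E}\,e(\alpha g_A(j)+\beta j)=\frac1n\sum_{j=1}^n e(\alpha g_A(j)+\beta j),\qquad e(x)=\exp(2\pi i x),$$ be the characteristic function of $(U,V)=(g_A(j),j)$, where $j$ is uniform on $[n]$ (and $A$ is fixed). Statement. There is an absolute constant $N$ such that for every integer $n\ge N$ and every real $\alpha$ with $|\alpha|\le 1/2$ the following holds. With probability at least $1-n^{-10}$ over the choice of a random $n$-sided die $A$, we have $$|\hat f(\alpha,\beta)|\le 1-\delta\quad\text{for every real }\beta,\qquad\text{where }\ \delta=\min\left(10^{-13},\;10^{-11}\,\frac{\alpha^2 n}{\log n}\right).$$ -/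

import Mathlib

noncomputable section

namespace IntransitiveDice

open scoped BigOperators

/-- The `n`-sided dice of the balanced sequences model: the sequences `(a_1, …, a_n)` of elements
of `{1, …, n}` whose sum is `n (n + 1) / 2`. -/
def dice (n : ℕ) : Set (Fin n → ℕ) :=
  {A | (∀ i, A i ∈ Set.Icc 1 n) ∧ 2 * ∑ i, A i = n * (n + 1)}

/-- The law of a random `n`-sided die: the uniform distribution on `dice n`. -/
def randomDie (n : ℕ) : MeasureTheory.Measure (Fin n → ℕ) :=
  ProbabilityTheory.uniformOn (dice n)

/-- `f_A(j) = |{i : a_i < j}| + (1/2) |{i : a_i = j}|`. -/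
def cdf {n : ℕ} (A : Fin n → ℕ) (j : ℕ) : ℝ :=
  ((Finset.univ.filter fun i => A i < j).card : ℝ) +
    (1 / 2) * ((Finset.univ.filter fun i => A i = j).card : ℝ)

/-- `g_A(j) = f_A(j) - j + 1/2`. -/
def g {n : ℕ} (A : Fin n → ℕ) (j : ℕ) : ℝ :=
  cdf A j - (j : ℝ) + 1 / 2

/-- `e(x) = exp(2 π i x)`. -/
def e (x : ℝ) : ℂ :=
  Complex.exp (2 * (Real.pi : ℂ) * Complex.I * (x : ℂ))

/-- The characteristic function `E e(α U + β V)` of `(U, V) = (g_A(j), j)`, where `j` is uniformly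
distributed on `{1, …, n}`. -/
def fHat {n : ℕ} (A : Fin n → ℕ) (α β : ℝ) : ℂ :=
  𝔼 j ∈ Finset.Icc 1 n, e (α * g A j + β * (j : ℝ))

/-- `δ = min (10^{-13}, 10^{-11} α² n / log n)`. -/
def delta (n : ℕ) (α : ℝ) : ℝ :=
  min ((10 : ℝ) ^ (-13 : ℤ)) ((10 : ℝ) ^ (-11 : ℤ) * (α ^ 2 * (n : ℝ) / Real.log (n : ℝ)))

theorem dice_finite (n : ℕ) : (dice n).Finite := by
  refine (Set.Finite.pi' (fun _ : Fin n => Set.finite_Icc 1 n)).subset ?_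
  intro A hA
  exact hA.1

theorem dice_nonempty (n : ℕ) : (dice n).Nonempty := by
  refine ⟨fun i => (i : ℕ) + 1, fun i => ⟨Nat.succ_pos _, i.isLt⟩, ?_⟩
  rw [Fin.sum_univ_eq_sum_range (fun i => i + 1) n]
  induction n with
  | zero => simp
  | succ k ih => rw [Finset.sum_range_succ, mul_add, ih]; ring

instance randomDie_isProbabilityMeasure (n : ℕ) :
    MeasureTheory.IsProbabilityMeasure (randomDie n) :=
  ProbabilityTheory.isProbabilityMeasure_uniformOn (dice_finite n) (dice_nonempty n)

end IntransitiveDice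

end

noncomputable section

namespace IntransitiveDice

open scoped BigOperators

/-! ### The characters `e` -/

/-! If `‖fHat A α β‖` is close to 1, the phases `α * g A j + β * j` are nearly constant modulo 1 for
most `j`. A second difference in `j` removes `β`, so the numbers `α * (g A j - 2 * g A (j + h) + g A
(j + 2 * h))` are then mostly close to integers. `sum_blockDefect_le` quantifies this with a defect
free of `β`, so one event serves all `β` at once.

The defect is bounded below by random swaps. Cut `{1, …, n}` into blocks of length `6 * u`. Moving a
face between two chosen cells of a block changes all `u` second differences used there by exactly
±1, and leaves the other blocks alone. Independent coins deciding the moves make each second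
difference fluctuate on scale `√u`; as `α ^ 2 * u` is small, or `u = 1`, this contributes a mean
squared defect of order `α ^ 2 * u` (`expect_exp_defect_le`). Since typically a block has about `2 *
u` tokens to move, the exponential moment of the total defect decays exponentially in the number of
blocks (`sum_prod_blockFactor_le`, `sum_prod_blockBound_le`).

Swaps do not preserve the sum of the faces, so all this is done for uniform sequences in `{1, …,
n}^n`. Passing to dice costs only a factor `n ^ 2` (`pow_le_card_dice`): failure probability `n ^
(-12)` becomes `n ^ (-10)`. -/

theorem e_add (x y : ℝ) : e (x + y) = e x * e y := by
  simp only [e, ← Complex.exp_add]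
  congr 1
  push_cast
  ring

theorem norm_e (x : ℝ) : ‖e x‖ = 1 := by
  have : (2 * (Real.pi : ℂ) * Complex.I * (x : ℂ)) = ((2 * Real.pi * x : ℝ) : ℂ) * Complex.I := by
    push_cast
    ring
  rw [e, this, Complex.norm_exp_ofReal_mul_I]

theorem norm_sub_one_sq {z : ℂ} (hz : ‖z‖ = 1) : ‖z - 1‖ ^ 2 = 2 * (1 - z.re) := by
  have h1 : z.re * z.re + z.im * z.im = 1 := by
    rw [← Complex.normSq_apply, Complex.normSq_eq_norm_sq, hz, one_pow]
  rw [← Complex.normSq_eq_norm_sq, Complex.normSq_apply]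
  simp only [Complex.sub_re, Complex.one_re, Complex.sub_im, Complex.one_im]
  linarith

theorem norm_e_sub_one_sq (x : ℝ) : ‖e x - 1‖ ^ 2 = 4 * Real.sin (Real.pi * x) ^ 2 := by
  have : (2 * (Real.pi : ℂ) * Complex.I * (x : ℂ)) = ((2 * (Real.pi * x) : ℝ) : ℂ) * Complex.I := by
    push_cast
    ring
  rw [norm_sub_one_sq (norm_e x), e, this, Complex.exp_ofReal_mul_I_re, Real.cos_two_mul,
    Real.cos_sq']
  ring

theorem norm_e_sub_e (x y : ℝ) : ‖e x - e y‖ = ‖e (x - y) - 1‖ := by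
  have h : e x - e y = (e (x - y) - 1) * e y := by
    rw [sub_mul, ← e_add, sub_add_cancel, one_mul]
  rw [h, norm_mul, norm_e, mul_one]

/-- Cauchy–Schwarz with weights 1, 1, 2 gives the factor 6, and `norm_sub_one_sq` doubles it. -/
theorem norm_mul_sub_sq_le {x y z : ℂ} (hx : ‖x‖ = 1) (hy : ‖y‖ = 1) (hz : ‖z‖ = 1) :
    ‖x * z - y ^ 2‖ ^ 2 ≤ 12 * ((1 - x.re) + (1 - y.re) + (1 - z.re)) := by
  have h1 : ‖x * z - y ^ 2‖ ≤ ‖z - 1‖ + ‖x - 1‖ + 2 * ‖y - 1‖ := by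
    have h : x * z - y ^ 2 = x * (z - 1) + (x - 1) - (y + 1) * (y - 1) := by ring
    rw [h]
    refine (norm_sub_le _ _).trans (add_le_add ((norm_add_le _ _).trans ?_) ?_)
    · rw [norm_mul, hx, one_mul]
    · rw [norm_mul]
      gcongr
      refine (norm_add_le _ _).trans ?_
      rw [hy, norm_one]
      norm_num
  have h2 := norm_sub_one_sq hx
  have h3 := norm_sub_one_sq hy
  have h4 := norm_sub_one_sq hz
  have h5 := pow_le_pow_left₀ (norm_nonneg _) h1 2
  nlinarith [sq_nonneg (‖x - 1‖ - ‖z - 1‖), sq_nonneg (2 * ‖x - 1‖ - ‖y - 1‖),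
    sq_nonneg (2 * ‖z - 1‖ - ‖y - 1‖)]

/-! ### Second differences of `g` -/

/-- The contribution of a face `v` to `f_A(j)`. -/
def faceWeight (v j : ℕ) : ℝ := if v < j then 1 else if v = j then 1 / 2 else 0

theorem cdf_eq_sum {n : ℕ} (A : Fin n → ℕ) (j : ℕ) : cdf A j = ∑ i, faceWeight (A i) j := by
  have h : ∀ i, faceWeight (A i) j =
      (if A i < j then (1 : ℝ) else 0) + 1 / 2 * (if A i = j then (1 : ℝ) else 0) := by
    intro i
    unfold faceWeight
    split_ifs <;> first | omega | norm_num
  simp only [h, Finset.sum_add_distrib, ← Finset.mul_sum, cdf, Finset.sum_boole]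

/-- The contribution of a face `v` to the second difference of `f_A` with step `h` at `j`. -/
def diffWeight (h j v : ℕ) : ℝ :=
  faceWeight v j - 2 * faceWeight v (j + h) + faceWeight v (j + 2 * h)

theorem sum_diffWeight {n : ℕ} (A : Fin n → ℕ) (h j : ℕ) :
    ∑ i, diffWeight h j (A i) = g A j - 2 * g A (j + h) + g A (j + 2 * h) := by
  simp only [diffWeight, Finset.sum_add_distrib, Finset.sum_sub_distrib, ← Finset.mul_sum,
    ← cdf_eq_sum, g]
  push_cast
  ring

theorem diffWeight_of_lt {h j v : ℕ} (hv : v < j) : diffWeight h j v = 0 := by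
  have h1 : v < j + h := by omega
  have h2 : v < j + 2 * h := by omega
  simp only [diffWeight, faceWeight, hv, h1, h2, if_true]
  norm_num

theorem diffWeight_of_gt {h j v : ℕ} (hv : j + 2 * h < v) : diffWeight h j v = 0 := by
  unfold diffWeight faceWeight
  rw [if_neg (by omega), if_neg (by omega), if_neg (by omega), if_neg (by omega),
    if_neg (by omega), if_neg (by omega)]
  norm_num

theorem diffWeight_of_mem {h j v : ℕ} (h1 : j + h < v) (h2 : v < j + 2 * h) :
    diffWeight h j v = 1 := by
  unfold diffWeight faceWeight
  rw [if_neg (by omega), if_neg (by omega), if_neg (by omega), if_neg (by omega),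
    if_pos (by omega)]
  norm_num

/-- The triples are disjoint: in a block of six intervals of length `u` they occupy the intervals 0,
2 and 4. -/
theorem sum_triples_le {n u K : ℕ} (hK : 6 * (u * K) ≤ n) {F : ℕ → ℝ} (hF : ∀ j, 0 ≤ F j) :
    ∑ b ∈ Finset.range K, ∑ r ∈ Finset.range u,
      (F (6 * (u * b) + 1 + r) + F (6 * (u * b) + 1 + r + 2 * u) +
        F (6 * (u * b) + 1 + r + 2 * (2 * u))) ≤ ∑ j ∈ Finset.Icc 1 n, F j := by
  have key : ∀ b r : ℕ, F (6 * (u * b) + 1 + r) + F (6 * (u * b) + 1 + r + 2 * u) +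
        F (6 * (u * b) + 1 + r + 2 * (2 * u)) =
      ∑ k ∈ Finset.range 3, F (u * (6 * b + 2 * k) + r + 1) := by
    intro b r
    simp only [Finset.sum_range_succ, Finset.sum_range_zero, zero_add]
    refine congrArg₂ _ (congrArg₂ _ ?_ ?_) ?_ <;> (congr 1; ring)
  simp only [key]
  rw [Finset.sum_comm' (t' := Finset.range u) (s' := fun _ => Finset.range K) (by simp)]
  simp only [← Finset.sum_product']
  have hinj : Set.InjOn (fun x : ℕ × ℕ × ℕ => u * (6 * x.2.1 + 2 * x.2.2) + x.1 + 1)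
      (Finset.range u ×ˢ Finset.range K ×ˢ Finset.range 3 : Finset (ℕ × ℕ × ℕ)) := by
    rintro ⟨r, b, k⟩ hx ⟨r', b', k'⟩ hx' h
    simp only [Finset.coe_product, Finset.coe_range, Set.mem_prod, Set.mem_Iio] at hx hx'
    simp only [add_left_inj] at h
    have hu : 0 < u := by omega
    have hq := congrArg (· / u) h
    simp only [Nat.mul_add_div hu, Nat.div_eq_of_lt hx.1, Nat.div_eq_of_lt hx'.1] at hq
    have hbk : b = b' ∧ k = k' := by omega
    obtain ⟨rfl, rfl⟩ := hbk
    simp only [Prod.mk.injEq, and_true]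
    omega
  have hsub : (Finset.range u ×ˢ Finset.range K ×ˢ Finset.range 3).image
      (fun x : ℕ × ℕ × ℕ => u * (6 * x.2.1 + 2 * x.2.2) + x.1 + 1) ⊆ Finset.Icc 1 n := by
    intro j hj
    simp only [Finset.mem_image, Finset.mem_product, Finset.mem_range, Prod.exists] at hj
    obtain ⟨r, b, k, ⟨hr, hb, hk⟩, rfl⟩ := hj
    rw [Finset.mem_Icc]
    have h1 : u * (6 * b + 2 * k + 1) ≤ u * (6 * K) := Nat.mul_le_mul_left _ (by omega)
    constructor
    · omega
    · nlinarith
  calc _ = ∑ j ∈ (Finset.range u ×ˢ Finset.range K ×ˢ Finset.range 3).image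
        (fun x : ℕ × ℕ × ℕ => u * (6 * x.2.1 + 2 * x.2.2) + x.1 + 1), F j := by
        rw [Finset.sum_image hinj]
    _ ≤ _ := Finset.sum_le_sum_of_subset_of_nonneg hsub fun j _ _ => hF j

/-- The total defect of the die `A` over the triples with step `2 * u`. -/
def blockDefect {n : ℕ} (α : ℝ) (u b : ℕ) (A : Fin n → ℕ) : ℝ :=
  ∑ r ∈ Finset.range u, ‖e (α * ∑ i, diffWeight (2 * u) (6 * (u * b) + 1 + r) (A i)) - 1‖ ^ 2

theorem sum_blockDefect_le {n u K : ℕ} (hn : 0 < n) (hK : 6 * (u * K) ≤ n) (A : Fin n → ℕ)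
    (α β : ℝ) :
    ∑ b ∈ Finset.range K, blockDefect α u b A ≤ 12 * (n * (1 - ‖fHat A α β‖)) := by
  -- Rotating by `w` makes the mean of the phases a nonnegative real, so `1 - ‖fHat A α β‖` is the
  -- mean of `1 - (z j).re`.
  obtain ⟨w, hw, hwf⟩ : ∃ w : ℂ, ‖w‖ = 1 ∧ w * fHat A α β = ‖fHat A α β‖ := by
    by_cases h0 : fHat A α β = 0
    · exact ⟨1, by simp, by simp [h0]⟩
    · have h0' : (‖fHat A α β‖ : ℂ) ≠ 0 := by simpa using h0
      refine ⟨‖fHat A α β‖ / fHat A α β, ?_, div_mul_cancel₀ _ h0⟩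
      rw [norm_div, Complex.norm_real, norm_norm, div_self (norm_ne_zero_iff.2 h0)]
  set z : ℕ → ℂ := fun j => w * e (α * g A j + β * j) with hz
  have hz1 : ∀ j, ‖z j‖ = 1 := fun j => by rw [hz]; simp [norm_e, hw]
  have hsum : ∑ j ∈ Finset.Icc 1 n, (1 - (z j).re) = n * (1 - ‖fHat A α β‖) := by
    have h1 : ∑ j ∈ Finset.Icc 1 n, z j = n * (‖fHat A α β‖ : ℂ) := by
      rw [← hwf, fHat, Finset.expect_eq_sum_div_card, hz, ← Finset.mul_sum]
      have : (n : ℂ) ≠ 0 := by exact_mod_cast hn.ne'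
      simp only [Nat.card_Icc, add_tsub_cancel_right]
      field_simp
    have h2 : ∑ j ∈ Finset.Icc 1 n, (z j).re = n * ‖fHat A α β‖ := by
      rw [← Complex.re_sum, h1, ← Complex.ofReal_natCast, ← Complex.ofReal_mul, Complex.ofReal_re]
    rw [Finset.sum_sub_distrib, h2]
    simp
    ring
  have hre : ∀ j, 0 ≤ 1 - (z j).re := fun j =>
    sub_nonneg.2 ((Complex.re_le_norm _).trans_eq (hz1 j))
  rw [← hsum]
  refine le_trans ?_ (mul_le_mul_of_nonneg_left (sum_triples_le hK hre) (by norm_num))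
  rw [Finset.mul_sum]
  refine Finset.sum_le_sum fun b _ => ?_
  rw [blockDefect, Finset.mul_sum]
  refine Finset.sum_le_sum fun r _ => ?_
  refine le_trans (le_of_eq ?_) (norm_mul_sub_sq_le (hz1 _) (hz1 _) (hz1 _))
  congr 1
  generalize 6 * (u * b) + 1 + r = j
  rw [sum_diffWeight]
  have : z j * z (j + 2 * (2 * u)) - z (j + 2 * u) ^ 2 = w ^ 2 *
      (e (α * g A j + β * j + (α * g A (j + 2 * (2 * u)) + β * (j + 2 * (2 * u) : ℕ))) -
        e (α * g A (j + 2 * u) + β * (j + 2 * u : ℕ) +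
          (α * g A (j + 2 * u) + β * (j + 2 * u : ℕ)))) := by
    rw [e_add, e_add (α * g A (j + 2 * u) + β * (j + 2 * u : ℕ)), hz]
    ring
  rw [this, norm_mul, norm_pow, hw, one_pow, one_mul, norm_e_sub_e]
  congr 3
  push_cast
  ring

/-! ### The number of dice -/

/-- Discrete intermediate value argument: reflecting all entries by `v ↦ n + 1 - v` negates the
excess of the sum. Reflecting one entry at a time, the excess changes sign at some index `k`, and
adjusting that entry alone gives a die. The sequence is recovered from the die, `k` and the old
entry, whence at most `n * n` preimages. -/
theorem pow_le_card_dice {n : ℕ} (hn : 0 < n) : n ^ n ≤ n * n * (dice n).ncard := by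
  classical
  set D := (dice_finite n).toFinset with hD
  have hDc : (dice n).ncard = D.card := Set.ncard_eq_toFinset_card _ _
  let Φ : (Fin n → ℕ) × Fin n × ℕ → (Fin n → ℕ) := fun p i =>
    if i < p.2.1 then n + 1 - p.1 i else if i = p.2.1 then p.2.2 else p.1 i
  have hsub : (Fintype.piFinset fun _ : Fin n => Finset.Icc 1 n) ⊆
      (D ×ˢ (Finset.univ : Finset (Fin n)) ×ˢ Finset.Icc 1 n).image Φ := by
    intro a ha
    simp only [Fintype.mem_piFinset, Finset.mem_Icc] at ha
    let b : ℕ → Fin n → ℤ := fun k i => if (i : ℕ) < k then n + 1 - a i else a i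
    let d : ℕ → ℤ := fun k => 2 * ∑ i, b k i - n * (n + 1)
    have hdn : d n = -d 0 := by
      have h : ∑ i, b n i = n * (n + 1) - ∑ i, b 0 i := by
        simp [b, Finset.sum_sub_distrib]
      simp only [d, h]
      ring
    have hds : ∀ k : Fin n, d (k + 1) = d k + 2 * (n + 1 - 2 * a k) := by
      intro k
      have h : ∀ i, b (k + 1) i = b k i + if i = k then ((n : ℤ) + 1 - 2 * a k) else 0 := by
        intro i
        have hik : i = k ↔ (i : ℕ) = k := Fin.ext_iff
        simp only [b]
        by_cases h : i = k
        · subst h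
          simp
          ring
        · rw [if_neg h]
          split_ifs <;> omega
      simp only [d, h, Finset.sum_add_distrib, Finset.sum_ite_eq', Finset.mem_univ, if_true]
      ring
    obtain ⟨k, hk⟩ : ∃ k : Fin n, d k * d (k + 1) ≤ 0 := by
      by_contra! hcon
      have hind : ∀ k, k ≤ n → 0 < k → 0 < d 0 * d k := by
        intro k hkn hk0
        induction k with
        | zero => omega
        | succ k ih =>
          have h1 := hcon ⟨k, by omega⟩
          simp only at h1
          rcases Nat.eq_zero_or_pos k with rfl | hk
          · exact h1
          · have h2 := ih (by omega) hk
            have h3 := mul_pos h2 h1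
            have h4 : 0 < d k ^ 2 * (d 0 * d (k + 1)) := by
              calc 0 < d 0 * d k * (d k * d (k + 1)) := h3
                _ = _ := by ring
            exact pos_of_mul_pos_right h4 (sq_nonneg _)
      have h := hind n le_rfl hn
      rw [hdn] at h
      nlinarith [sq_nonneg (d 0)]
    obtain ⟨m, hm⟩ : ∃ m : ℤ, d k = 2 * m := by
      obtain ⟨m, hm⟩ := Int.even_mul_succ_self (n : ℤ)
      exact ⟨∑ i, b k i - m, by simp only [d, hm]; ring⟩
    have hak := ha k
    -- The sign change puts `a k - m` between `a k` and its reflection `n + 1 - a k`.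
    have hy : 1 ≤ a k - m ∧ a k - m ≤ n := by
      have h1 := hds k
      rcases mul_nonpos_iff.1 hk with h | h <;> constructor <;> omega
    let A : Fin n → ℕ := fun i =>
      if i < k then n + 1 - a i else if i = k then (a k - m).toNat else a i
    have hAs : ∀ i, (A i : ℤ) = b k i - if i = k then m else 0 := by
      intro i
      have hi := ha i
      simp only [A, b, Fin.lt_def]
      split_ifs with h1 h2 h3
      · omega
      · omega
      · rw [h3]
        omega
      · omega
    have hA : A ∈ D := by
      rw [hD, Set.Finite.mem_toFinset]
      refine ⟨fun i => ?_, ?_⟩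
      · have hi := ha i
        simp only [A, Set.mem_Icc]
        split_ifs <;> omega
      · zify
        simp only [hAs, Finset.sum_sub_distrib, Finset.sum_ite_eq', Finset.mem_univ, if_true]
        simp only [d] at hm
        linarith
    refine Finset.mem_image.2 ⟨(A, k, a k), ?_, ?_⟩
    · simp [hA, hak]
    · funext i
      have hi := ha i
      simp only [Φ, A]
      split_ifs with h1 h2
      · omega
      · rw [h2]
      · rfl
  have h := (Finset.card_le_card hsub).trans Finset.card_image_le
  simp only [Fintype.card_piFinset, Finset.card_product, Nat.card_Icc, Finset.card_univ,
    Fintype.card_fin, Finset.prod_const, add_tsub_cancel_right, ← hDc] at h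
  linarith [mul_comm (n * n) (dice n).ncard]

/-! ### Signed sums -/

/-- The signed sum of `s` over `T`, with signs `ε`. -/
def signedSum {n : ℕ} (s : Fin n → ℝ) (T : Finset (Fin n)) (ε : Fin n → ℤˣ) : ℝ :=
  ∑ i ∈ T, s i * ((ε i : ℤ) : ℝ)

theorem expect_mul_eq {n : ℕ} (t : Fin n → ℤˣ) (F : (Fin n → ℤˣ) → ℝ) :
    𝔼 ε, F (t * ε) = 𝔼 ε, F ε :=
  Fintype.expect_equiv (Equiv.mulLeft t) _ _ fun _ => rfl

theorem expect_mul_sign_eq_zero {n : ℕ} {i : Fin n} {F : (Fin n → ℤˣ) → ℝ}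
    (hF : ∀ ε, F (Function.update (1 : Fin n → ℤˣ) i (-1) * ε) = F ε) :
    𝔼 ε, F ε * ((ε i : ℤ) : ℝ) = 0 := by
  have h := expect_mul_eq (Function.update (1 : Fin n → ℤˣ) i (-1)) fun ε => F ε * ((ε i : ℤ) : ℝ)
  simp only [hF, Pi.mul_apply, Function.update_self, neg_mul, one_mul, Units.val_neg, Int.cast_neg,
    mul_neg, Finset.expect_neg_distrib] at h
  linarith

theorem sign_sq (x : ℤˣ) : ((x : ℤ) : ℝ) ^ 2 = 1 := by
  rcases Int.units_eq_one_or x with rfl | rfl <;> simp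

theorem signedSum_update {n : ℕ} {s : Fin n → ℝ} {T : Finset (Fin n)} {i : Fin n} (hi : i ∉ T)
    (ε : Fin n → ℤˣ) : signedSum s T (Function.update (1 : Fin n → ℤˣ) i (-1) * ε) = signedSum s T ε := by
  refine Finset.sum_congr rfl fun j hj => ?_
  have : j ≠ i := fun h => hi (h ▸ hj)
  simp [this]

theorem expect_signedSum_sq {n : ℕ} {s : Fin n → ℝ} {T : Finset (Fin n)}
    (hs : ∀ i ∈ T, s i ^ 2 = 1) : 𝔼 ε, signedSum s T ε ^ 2 = T.card := by
  classical
  induction T using Finset.induction_on with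
  | empty => simp [signedSum]
  | insert i T hi ih =>
    have hsi := hs i (Finset.mem_insert_self _ _)
    have h : ∀ ε, signedSum s (insert i T) ε ^ 2 =
        signedSum s T ε ^ 2 + 1 + 2 * s i * (signedSum s T ε * ((ε i : ℤ) : ℝ)) := by
      intro ε
      have h1 : signedSum s (insert i T) ε = s i * ((ε i : ℤ) : ℝ) + signedSum s T ε :=
        Finset.sum_insert hi
      rw [h1]
      linear_combination hsi * ((ε i : ℤ) : ℝ) ^ 2 + sign_sq (ε i)
    have h0 : 𝔼 ε : Fin n → ℤˣ, signedSum s T ε * ((ε i : ℤ) : ℝ) = 0 :=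
      expect_mul_sign_eq_zero fun ε => signedSum_update hi ε
    simp only [h, Finset.expect_add_distrib, ← Finset.mul_expect, h0,
      ih fun j hj => hs j (Finset.mem_insert_of_mem hj), Finset.card_insert_of_notMem hi,
      Fintype.expect_const]
    push_cast
    ring

theorem expect_signedSum_pow_four_le {n : ℕ} {s : Fin n → ℝ} {T : Finset (Fin n)}
    (hs : ∀ i ∈ T, s i ^ 2 = 1) : 𝔼 ε, signedSum s T ε ^ 4 ≤ 3 * (T.card : ℝ) ^ 2 := by
  classical
  induction T using Finset.induction_on with
  | empty => simp [signedSum]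
  | insert i T hi ih =>
    have hsi := hs i (Finset.mem_insert_self _ _)
    have hsT : ∀ j ∈ T, s j ^ 2 = 1 := fun j hj => hs j (Finset.mem_insert_of_mem hj)
    have h : ∀ ε, signedSum s (insert i T) ε ^ 4 =
        signedSum s T ε ^ 4 + 6 * signedSum s T ε ^ 2 + 1 +
          4 * s i * ((signedSum s T ε ^ 3 + signedSum s T ε) * ((ε i : ℤ) : ℝ)) := by
      intro ε
      have h1 : signedSum s (insert i T) ε = s i * ((ε i : ℤ) : ℝ) + signedSum s T ε :=
        Finset.sum_insert hi
      rw [h1]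
      have hy : (s i * ((ε i : ℤ) : ℝ)) ^ 2 = 1 := by rw [mul_pow, hsi, sign_sq, one_mul]
      have hy4 : (s i * ((ε i : ℤ) : ℝ)) ^ 4 = 1 := by
        rw [show (4 : ℕ) = 2 * 2 from rfl, pow_mul, hy, one_pow]
      have hy3 : (s i * ((ε i : ℤ) : ℝ)) ^ 3 = s i * ((ε i : ℤ) : ℝ) := by
        rw [pow_succ, hy, one_mul]
      linear_combination hy4 + 4 * signedSum s T ε * hy3 + 6 * signedSum s T ε ^ 2 * hy
    have h0 : 𝔼 ε : Fin n → ℤˣ,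
        (signedSum s T ε ^ 3 + signedSum s T ε) * ((ε i : ℤ) : ℝ) = 0 :=
      expect_mul_sign_eq_zero (F := fun ε => signedSum s T ε ^ 3 + signedSum s T ε)
        fun ε => by simp only [signedSum_update hi]
    simp only [h, Finset.expect_add_distrib, ← Finset.mul_expect]
    rw [h0, expect_signedSum_sq hsT, Fintype.expect_const, Finset.card_insert_of_notMem hi]
    push_cast
    linarith [ih hsT]

/-- From `1 + x ≤ exp x` and `(1 + x) * (1 - x + x ^ 2) = 1 + x ^ 3`. -/
theorem exp_neg_le {x : ℝ} (hx : 0 ≤ x) : Real.exp (-x) ≤ 1 - x + x ^ 2 := by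
  rw [Real.exp_neg, inv_le_comm₀ (Real.exp_pos _) (by nlinarith [sq_nonneg (x - 1 / 2)])]
  refine le_trans ?_ (Real.add_one_le_exp x)
  rw [inv_le_iff_one_le_mul₀ (by nlinarith [sq_nonneg (x - 1 / 2)])]
  nlinarith [pow_nonneg hx 3]

theorem sq_sub_pow_four_le_sin_sq (t : ℝ) : t ^ 2 - t ^ 4 ≤ Real.sin t ^ 2 := by
  wlog ht : 0 ≤ t generalizing t
  · have := this (-t) (by linarith)
    rw [Real.sin_neg, neg_sq, neg_sq, show (-t) ^ 4 = t ^ 4 by ring] at this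
    exact this
  rcases le_or_gt t 1 with h1 | h1
  · rcases ht.eq_or_lt with rfl | h0
    · simp
    · have h := Real.sin_gt_sub_cube h0
      have h2 : 0 ≤ t - t ^ 3 / 6 := by nlinarith [pow_nonneg ht 2]
      nlinarith [pow_le_pow_left₀ h2 h.le 2, sq_nonneg (t ^ 3), pow_nonneg ht 4]
  · nlinarith [sq_nonneg (Real.sin t), mul_pos (pow_pos (zero_lt_one.trans h1) 2)
      (show 0 < t ^ 2 - 1 by nlinarith)]

/-- The exponent used for a block with `M` free tokens. -/
def rate (α : ℝ) (M : ℕ) : ℝ := 1 / (12 * (Real.pi ^ 2 * α ^ 2 * M))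

theorem rate_nonneg (α : ℝ) (M : ℕ) : 0 ≤ rate α M := by
  unfold rate
  positivity

theorem pi_sq_le_ten : Real.pi ^ 2 ≤ 10 := by
  nlinarith [Real.pi_lt_d2, Real.pi_pos]

/-- For one token the sine is deterministic up to sign and Jordan's inequality suffices, for every
`|α| ≤ 1 / 2`. Otherwise expand to fourth order and use the second and fourth moments of the signed
sum: with `y = π² α² |T| ≤ 1 / 6` and `rate * y = 1 / 12` the bound is `1 - 1/12 + 1/24 + 1/48 =
47/48`. -/
theorem expect_exp_sin_sq_le {n : ℕ} {s : Fin n → ℝ} {T : Finset (Fin n)}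
    (hs : ∀ i ∈ T, s i ^ 2 = 1) (hT : 0 < T.card) {α : ℝ} (hα0 : α ≠ 0) (hα : |α| ≤ 1 / 2)
    (hc : T.card = 1 ∨ Real.pi ^ 2 * α ^ 2 * T.card ≤ 1 / 6) :
    𝔼 ε, Real.exp (-(rate α T.card * Real.sin (Real.pi * (α * signedSum s T ε)) ^ 2)) ≤
      47 / 48 := by
  have hα2 : 0 < α ^ 2 := by positivity
  have hpi := Real.pi_pos
  have hr := rate_nonneg α T.card
  rcases hc with h1 | hc
  · have hW : ∀ ε, Real.sin (Real.pi * (α * signedSum s T ε)) ^ 2 =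
        Real.sin (Real.pi * |α|) ^ 2 := by
      intro ε
      obtain ⟨i, rfl⟩ := Finset.card_eq_one.1 h1
      have hsq : (signedSum s {i} ε) ^ 2 = 1 := by
        rw [signedSum, Finset.sum_singleton, mul_pow, hs i (Finset.mem_singleton_self i), sign_sq,
          one_mul]
      rcases mul_self_eq_one_iff.1 ((sq _).symm.trans hsq) with h | h <;> rcases abs_choice α with h' | h' <;>
        simp [h, h']
    have hsin : 2 * |α| ≤ Real.sin (Real.pi * |α|) := by
      have h := Real.mul_le_sin (x := Real.pi * |α|) (by positivity) (by nlinarith)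
      calc 2 * |α| = 2 / Real.pi * (Real.pi * |α|) := by field_simp
        _ ≤ _ := h
    have hsin2 : 4 * α ^ 2 ≤ Real.sin (Real.pi * |α|) ^ 2 := by
      have := pow_le_pow_left₀ (by positivity) hsin 2
      rwa [mul_pow, sq_abs, show (2 : ℝ) ^ 2 = 4 by norm_num] at this
    have hx : 1 / 30 ≤ rate α T.card * Real.sin (Real.pi * |α|) ^ 2 := by
      refine le_trans ?_ (mul_le_mul_of_nonneg_left hsin2 hr)
      rw [rate, h1, Nat.cast_one, mul_one, one_div_mul_eq_div, le_div_iff₀ (by positivity)]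
      nlinarith [pi_sq_le_ten]
    simp only [hW, Fintype.expect_const]
    refine (Real.exp_le_exp.2 (neg_le_neg hx)).trans ((exp_neg_le (by norm_num)).trans ?_)
    norm_num
  · have hM : (0 : ℝ) < T.card := by exact_mod_cast hT
    set y := Real.pi ^ 2 * α ^ 2 * T.card with hy
    have hy0 : 0 < y := by positivity
    have hl : rate α T.card = 1 / (12 * y) := rfl
    set l := rate α T.card
    have hly : l * y = 1 / 12 := by
      rw [hl]
      field_simp
    have hpt : ∀ ε, Real.exp (-(l * Real.sin (Real.pi * (α * signedSum s T ε)) ^ 2)) ≤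
        1 - l * (Real.pi * α) ^ 2 * signedSum s T ε ^ 2 +
          (l + l ^ 2) * (Real.pi * α) ^ 4 * signedSum s T ε ^ 4 := by
      intro ε
      refine (exp_neg_le (mul_nonneg hr (sq_nonneg _))).trans ?_
      set t := Real.pi * (α * signedSum s T ε) with ht
      have h1 := mul_le_mul_of_nonneg_left (sq_sub_pow_four_le_sin_sq t) hr
      have h2 : Real.sin t ^ 2 ≤ t ^ 2 := sq_le_sq.2 Real.abs_sin_le_abs
      have h3 : (l * Real.sin t ^ 2) ^ 2 ≤ l ^ 2 * t ^ 4 := by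
        have := pow_le_pow_left₀ (mul_nonneg hr (sq_nonneg _)) (mul_le_mul_of_nonneg_left h2 hr) 2
        calc _ ≤ _ := this
          _ = _ := by ring
      calc _ ≤ 1 - l * (t ^ 2 - t ^ 4) + l ^ 2 * t ^ 4 := by linarith
        _ = _ := by rw [ht]; ring
    refine (Finset.expect_le_expect fun ε _ => hpt ε).trans ?_
    simp only [Finset.expect_add_distrib, Finset.expect_sub_distrib, ← Finset.mul_expect,
      Fintype.expect_const, expect_signedSum_sq hs]
    have h4 := mul_le_mul_of_nonneg_left (expect_signedSum_pow_four_le hs)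
      (show 0 ≤ (l + l ^ 2) * (Real.pi * α) ^ 4 by positivity)
    have e1 : l * (Real.pi * α) ^ 2 * T.card = 1 / 12 := by
      rw [← hly, hy]
      ring
    have e2 : (l + l ^ 2) * (Real.pi * α) ^ 4 * (3 * (T.card : ℝ) ^ 2) =
        3 * (l * y) * y + 3 * (l * y) ^ 2 := by
      rw [hy]
      ring
    rw [e1]
    rw [e2, hly] at h4
    linarith

/-! ### Random swaps of faces -/

/-- Apply `σ` to the faces whose sign is `-1`. -/
def applyCoins {n : ℕ} (σ : ℕ → ℕ) (ε : Fin n → ℤˣ) (a : Fin n → ℕ) : Fin n → ℕ :=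
  fun i => if ε i = 1 then a i else σ (a i)

/-- The value before the swaps is arbitrary, so `ε` is paired with its flip on `T`. The two sums
differ by a signed sum over `T`; if that difference times `α` is far from an integer, the two phases
cannot both be near 1. One factor is bounded by 1, giving `(1 + 47/48) / 2`. -/
theorem expect_exp_defect_le {n : ℕ} {w : ℕ → ℝ} {σ : ℕ → ℕ} {a : Fin n → ℕ} {T : Finset (Fin n)}
    (hs : ∀ i ∈ T, (w (a i) - w (σ (a i))) ^ 2 = 1) (hT : 0 < T.card) {α : ℝ} (hα0 : α ≠ 0)
    (hα : |α| ≤ 1 / 2) (hc : T.card = 1 ∨ Real.pi ^ 2 * α ^ 2 * T.card ≤ 1 / 6) :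
    𝔼 ε, Real.exp (-(rate α T.card * ‖e (α * ∑ i, w (applyCoins σ ε a i)) - 1‖ ^ 2)) ≤
      95 / 96 := by
  classical
  set X : (Fin n → ℤˣ) → ℝ := fun ε =>
    Real.exp (-(rate α T.card * ‖e (α * ∑ i, w (applyCoins σ ε a i)) - 1‖ ^ 2)) with hX
  set Y : (Fin n → ℤˣ) → ℝ := fun ε => Real.exp (-(rate α T.card * Real.sin (Real.pi *
    (α * signedSum (fun i => w (a i) - w (σ (a i))) T ε)) ^ 2)) with hY
  let t : Fin n → ℤˣ := fun i => if i ∈ T then -1 else 1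
  have hdiff : ∀ ε : Fin n → ℤˣ, ∑ i, w (applyCoins σ ε a i) - ∑ i, w (applyCoins σ (t * ε) a i) =
      signedSum (fun i => w (a i) - w (σ (a i))) T ε := by
    intro ε
    rw [← Finset.sum_sub_distrib, signedSum, ← Finset.sum_filter_add_sum_filter_not _ (· ∈ T),
      Finset.filter_mem_eq_inter, Finset.univ_inter]
    rw [Finset.sum_eq_zero (s := Finset.univ.filter (· ∉ T)), add_zero]
    · refine Finset.sum_congr rfl fun i hi => ?_
      rcases Int.units_eq_one_or (ε i) with h | h <;> simp [applyCoins, t, hi, h]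
    · intro i hi
      simp only [Finset.mem_filter, Finset.mem_univ, true_and] at hi
      simp [applyCoins, t, hi]
  have hpair : ∀ ε, X ε + X (t * ε) ≤ 1 + Y ε := by
    intro ε
    have hr := rate_nonneg α T.card
    simp only [hX, hY, ← hdiff]
    set x := ∑ i, w (applyCoins σ ε a i)
    set y := ∑ i, w (applyCoins σ (t * ε) a i)
    have h1 : 4 * Real.sin (Real.pi * (α * (x - y))) ^ 2 ≤
        (‖e (α * x) - 1‖ + ‖e (α * y) - 1‖) ^ 2 := by
      rw [← norm_e_sub_one_sq, mul_sub, ← norm_e_sub_e]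
      refine pow_le_pow_left₀ (norm_nonneg _) ?_ 2
      rw [← norm_neg (e (α * y) - 1)]
      refine le_trans (le_of_eq ?_) (norm_add_le _ _)
      congr 1
      ring
    have hone : ∀ z : ℝ, Real.exp (-(rate α T.card * z ^ 2)) ≤ 1 := fun z =>
      Real.exp_le_one_iff.2 (neg_nonpos.2 (mul_nonneg hr (sq_nonneg _)))
    rcases le_total ‖e (α * x) - 1‖ ‖e (α * y) - 1‖ with h | h
    · refine add_le_add (hone _) (Real.exp_le_exp.2 (neg_le_neg (mul_le_mul_of_nonneg_left ?_ hr)))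
      nlinarith [norm_nonneg (e (α * x) - 1)]
    · rw [add_comm]
      refine add_le_add (hone _) (Real.exp_le_exp.2 (neg_le_neg (mul_le_mul_of_nonneg_left ?_ hr)))
      nlinarith [norm_nonneg (e (α * y) - 1)]
  have h1 : 𝔼 ε, (X ε + X (t * ε)) ≤ 𝔼 ε, (1 + Y ε) :=
    Finset.expect_le_expect fun ε _ => hpair ε
  rw [Finset.expect_add_distrib, Finset.expect_add_distrib, expect_mul_eq t X,
    Fintype.expect_const] at h1
  have h2 : 𝔼 ε, Y ε ≤ 47 / 48 := expect_exp_sin_sq_le hs hT hα0 hα hc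
  linarith

theorem applyCoins_involutive {n : ℕ} {σ : ℕ → ℕ} (hσ : Function.Involutive σ)
    (ε : Fin n → ℤˣ) : Function.Involutive (applyCoins σ ε) := by
  intro a
  funext i
  simp only [applyCoins]
  split_ifs
  · rfl
  · exact hσ _

/-- The sequences of length `n` with entries in `{1, …, n}`. -/
def faceSeqs (n : ℕ) : Finset (Fin n → ℕ) := Fintype.piFinset fun _ => Finset.Icc 1 n

theorem applyCoins_mem {n : ℕ} {σ : ℕ → ℕ} (hσn : ∀ v ∈ Finset.Icc 1 n, σ v ∈ Finset.Icc 1 n)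
    {a : Fin n → ℕ} (ha : a ∈ faceSeqs n) (ε : Fin n → ℤˣ) : applyCoins σ ε a ∈ faceSeqs n := by
  rw [faceSeqs, Fintype.mem_piFinset] at ha ⊢
  intro i
  simp only [applyCoins]
  split_ifs
  · exact ha i
  · exact hσn _ (ha i)

/-- For fixed coins, `applyCoins σ ε` permutes `faceSeqs n`, so averaging over coins leaves the sum
unchanged. -/
theorem sum_mul_le_of_expect_le {n : ℕ} {σ : ℕ → ℕ} (hσ : Function.Involutive σ)
    (hσn : ∀ v ∈ Finset.Icc 1 n, σ v ∈ Finset.Icc 1 n) {P F G : (Fin n → ℕ) → ℝ}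
    (hP0 : ∀ a, 0 ≤ P a) (hP : ∀ ε a, P (applyCoins σ ε a) = P a)
    (hF : ∀ a, 𝔼 ε, F (applyCoins σ ε a) ≤ G a) :
    ∑ a ∈ faceSeqs n, P a * F a ≤ ∑ a ∈ faceSeqs n, P a * G a := by
  have h : ∀ ε : Fin n → ℤˣ, ∑ a ∈ faceSeqs n, P a * F (applyCoins σ ε a) =
      ∑ a ∈ faceSeqs n, P a * F a := by
    intro ε
    refine Finset.sum_nbij' (applyCoins σ ε) (applyCoins σ ε)
      (fun a ha => applyCoins_mem hσn ha ε) (fun a ha => applyCoins_mem hσn ha ε)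
      (fun a _ => applyCoins_involutive hσ ε a) (fun a _ => applyCoins_involutive hσ ε a)
      (fun a _ => by rw [hP])
  calc ∑ a ∈ faceSeqs n, P a * F a
      = 𝔼 ε : Fin n → ℤˣ, ∑ a ∈ faceSeqs n, P a * F (applyCoins σ ε a) := by
        simp only [h, Fintype.expect_const]
    _ = ∑ a ∈ faceSeqs n, P a * 𝔼 ε, F (applyCoins σ ε a) := by
        rw [Finset.expect_sum_comm]
        simp only [Finset.mul_expect]
    _ ≤ _ := Finset.sum_le_sum fun a _ => mul_le_mul_of_nonneg_left (hF a) (hP0 a)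

/-! ### Blocks of faces -/

/-- The two intervals of faces of the block `b` that get swapped. -/
def InCells (u b v : ℕ) : Prop :=
  (6 * (u * b) + 1 + 3 * u ≤ v ∧ v < 6 * (u * b) + 1 + 4 * u) ∨
    (6 * (u * b) + 1 + 5 * u ≤ v ∧ v < 6 * (u * b) + 1 + 6 * u)

instance (u b : ℕ) : DecidablePred (InCells u b) := fun _ => by
  unfold InCells
  infer_instance

/-- The involution exchanging the two intervals `InCells u b`. -/
def swap (u b v : ℕ) : ℕ :=
  if 6 * (u * b) + 1 + 3 * u ≤ v ∧ v < 6 * (u * b) + 1 + 4 * u then v + 2 * u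
  else if 6 * (u * b) + 1 + 5 * u ≤ v ∧ v < 6 * (u * b) + 1 + 6 * u then v - 2 * u
  else v

theorem swap_involutive (u b : ℕ) : Function.Involutive (swap u b) := by
  intro v
  unfold swap
  split_ifs <;> omega

theorem mul_add_le_or {u b c : ℕ} (h : b ≠ c) : u * b + u ≤ u * c ∨ u * c + u ≤ u * b := by
  rcases lt_or_gt_of_ne h with h | h
  · exact Or.inl (by simpa [mul_add] using Nat.mul_le_mul_left u (Nat.succ_le_of_lt h))
  · exact Or.inr (by simpa [mul_add] using Nat.mul_le_mul_left u (Nat.succ_le_of_lt h))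

theorem mul_add_le_of_lt {u b K : ℕ} (h : b < K) : u * b + u ≤ u * K := by
  simpa [mul_add] using Nat.mul_le_mul_left u (Nat.succ_le_of_lt h)

theorem swap_mem {n u b K : ℕ} (hK : 6 * (u * K) ≤ n) (hb : b < K) :
    ∀ v ∈ Finset.Icc 1 n, swap u b v ∈ Finset.Icc 1 n := by
  intro v hv
  have h := mul_add_le_of_lt (u := u) hb
  rw [Finset.mem_Icc] at hv ⊢
  unfold swap
  split_ifs <;> omega

theorem inCells_swap {u b c v : ℕ} : InCells u c (swap u b v) ↔ InCells u c v := by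
  rcases eq_or_ne b c with rfl | h
  · unfold InCells swap
    split_ifs <;> omega
  · have h := mul_add_le_or (u := u) h
    unfold InCells swap
    split_ifs <;> omega

theorem InCells.eq {u b c v : ℕ} (hb : InCells u b v) (hc : InCells u c v) : b = c := by
  by_contra h
  have h := mul_add_le_or (u := u) h
  unfold InCells at hb hc
  omega

theorem diffWeight_swap_of_ne {u b c r v : ℕ} (h : b ≠ c) (hr : r < u) :
    diffWeight (2 * u) (6 * (u * c) + 1 + r) (swap u b v) =
      diffWeight (2 * u) (6 * (u * c) + 1 + r) v := by
  have h := mul_add_le_or (u := u) h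
  unfold swap
  split_ifs with h1 h2
  · rcases h with h | h
    · rw [diffWeight_of_lt (by omega), diffWeight_of_lt (by omega)]
    · rw [diffWeight_of_gt (by omega), diffWeight_of_gt (by omega)]
  · rcases h with h | h
    · rw [diffWeight_of_lt (by omega), diffWeight_of_lt (by omega)]
    · rw [diffWeight_of_gt (by omega), diffWeight_of_gt (by omega)]
  · rfl

/-- For every offset `r < u`, the lower cell lies strictly between `j + 2 * u` and `j + 4 * u`, and
the upper one beyond `j + 4 * u`. One swap thus serves all offsets. -/
theorem diffWeight_sub_swap_sq {u b r v : ℕ} (hr : r < u) (hv : InCells u b v) :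
    (diffWeight (2 * u) (6 * (u * b) + 1 + r) v -
      diffWeight (2 * u) (6 * (u * b) + 1 + r) (swap u b v)) ^ 2 = 1 := by
  unfold swap
  rcases hv with h | h
  · rw [if_pos h, diffWeight_of_mem (by omega) (by omega), diffWeight_of_gt (by omega)]
    norm_num
  · rw [if_neg (by omega), if_pos h, diffWeight_of_gt (by omega),
      diffWeight_of_mem (by omega) (by omega)]
    norm_num

/-- The positions of `a` whose faces lie in the cells of the block `b`. -/
def tokens {n : ℕ} (u b : ℕ) (a : Fin n → ℕ) : Finset (Fin n) :=
  Finset.univ.filter fun i => InCells u b (a i)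

theorem tokens_applyCoins {n : ℕ} (u b c : ℕ) (ε : Fin n → ℤˣ) (a : Fin n → ℕ) :
    tokens u c (applyCoins (swap u b) ε a) = tokens u c a := by
  refine Finset.filter_congr fun i _ => ?_
  simp only [applyCoins]
  split_ifs
  · rfl
  · exact inCells_swap

theorem blockDefect_applyCoins_of_ne {n : ℕ} (α : ℝ) {u b c : ℕ} (h : b ≠ c) (ε : Fin n → ℤˣ)
    (a : Fin n → ℕ) :
    blockDefect α u c (applyCoins (swap u b) ε a) = blockDefect α u c a := by
  refine Finset.sum_congr rfl fun r hr => ?_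
  have hw : ∀ i, diffWeight (2 * u) (6 * (u * c) + 1 + r) (applyCoins (swap u b) ε a i) =
      diffWeight (2 * u) (6 * (u * c) + 1 + r) (a i) := by
    intro i
    simp only [applyCoins]
    split_ifs
    · rfl
    · exact diffWeight_swap_of_ne h (Finset.mem_range.1 hr)
  simp only [hw]

/-- The bound for the expectation of the factor of the block `b`, given its number of tokens. -/
def blockBound {n : ℕ} (u b : ℕ) (a : Fin n → ℕ) : ℝ :=
  if u ≤ (tokens u b a).card then 95 / 96 else 1

theorem blockDefect_nonneg {n : ℕ} (α : ℝ) (u b : ℕ) (a : Fin n → ℕ) : 0 ≤ blockDefect α u b a :=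
  Finset.sum_nonneg fun _ _ => sq_nonneg _

/-- The factor of the block `b` in the exponential moment of the total defect. -/
def blockFactor {n : ℕ} (α : ℝ) (u b : ℕ) (a : Fin n → ℕ) : ℝ :=
  Real.exp (-(rate α u / u * blockDefect α u b a))

theorem blockFactor_le_one {n : ℕ} (α : ℝ) (u b : ℕ) (a : Fin n → ℕ) : blockFactor α u b a ≤ 1 :=
  Real.exp_le_one_iff.2 (neg_nonpos.2 (mul_nonneg (div_nonneg (rate_nonneg _ _) (Nat.cast_nonneg _))
    (blockDefect_nonneg _ _ _ _)))

theorem blockFactor_le_sum {n : ℕ} (α : ℝ) {u : ℕ} (hu : 0 < u) (b : ℕ) (a : Fin n → ℕ) :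
    blockFactor α u b a ≤ ∑ r ∈ Finset.range u, (1 / (u : ℝ)) * Real.exp (-(rate α u *
      ‖e (α * ∑ i, diffWeight (2 * u) (6 * (u * b) + 1 + r) (a i)) - 1‖ ^ 2)) := by
  have hu' : (u : ℝ) ≠ 0 := by exact_mod_cast hu.ne'
  have h := convexOn_exp.map_sum_le (t := Finset.range u) (w := fun _ => 1 / (u : ℝ))
    (p := fun r => -(rate α u *
      ‖e (α * ∑ i, diffWeight (2 * u) (6 * (u * b) + 1 + r) (a i)) - 1‖ ^ 2))
    (fun _ _ => by positivity) (by simp [hu']) (fun _ _ => Set.mem_univ _)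
  simp only [smul_eq_mul] at h
  refine le_trans (le_of_eq ?_) h
  rw [blockFactor, blockDefect, ← Finset.mul_sum, Finset.sum_neg_distrib, ← Finset.mul_sum]
  congr 1
  ring

theorem expect_blockFactor_le {n u : ℕ} (hu : 0 < u) {α : ℝ} (hα0 : α ≠ 0) (hα : |α| ≤ 1 / 2)
    (hc : u = 1 ∨ Real.pi ^ 2 * α ^ 2 * u ≤ 1 / 6) (b : ℕ) (a : Fin n → ℕ) :
    𝔼 ε, blockFactor α u b (applyCoins (swap u b) ε a) ≤ blockBound u b a := by
  unfold blockBound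
  split_ifs with h
  -- Exactly `u` tokens are used, to match `rate α u`; coins of other tokens only shift the base
  -- value.
  · obtain ⟨T, hT, rfl⟩ := Finset.exists_subset_card_eq h
    set u := T.card
    have hu' : (u : ℝ) ≠ 0 := by exact_mod_cast hu.ne'
    refine (Finset.expect_le_expect fun ε _ => blockFactor_le_sum α hu b _).trans ?_
    rw [Finset.expect_sum_comm]
    simp only [← Finset.mul_expect]
    have hr : ∀ r ∈ Finset.range u, 1 / (u : ℝ) * 𝔼 ε : Fin n → ℤˣ, Real.exp (-(rate α u *
        ‖e (α * ∑ i, diffWeight (2 * u) (6 * (u * b) + 1 + r)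
          (applyCoins (swap u b) ε a i)) - 1‖ ^ 2)) ≤ 1 / (u : ℝ) * (95 / 96) := by
      intro r hr
      refine mul_le_mul_of_nonneg_left ?_ (by positivity)
      refine expect_exp_defect_le (fun i hi => ?_) hu hα0 hα hc
      exact diffWeight_sub_swap_sq (Finset.mem_range.1 hr) (Finset.mem_filter.1 (hT hi)).2
    refine (Finset.sum_le_sum hr).trans (le_of_eq ?_)
    rw [Finset.sum_const, Finset.card_range, nsmul_eq_mul]
    field_simp
  · refine (Finset.expect_le_expect fun ε _ => blockFactor_le_one α u b _).trans (le_of_eq ?_)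
    exact Fintype.expect_const _

theorem blockFactor_nonneg {n : ℕ} (α : ℝ) (u b : ℕ) (a : Fin n → ℕ) : 0 ≤ blockFactor α u b a :=
  (Real.exp_pos _).le

theorem blockBound_nonneg {n : ℕ} (u b : ℕ) (a : Fin n → ℕ) : 0 ≤ blockBound u b a := by
  unfold blockBound
  split_ifs <;> norm_num

/-- Blocks are replaced one by one: swaps in block `k` change neither the defects of other blocks
nor any token count. -/
theorem sum_prod_blockFactor_le {n u K : ℕ} (hu : 0 < u) (hK : 6 * (u * K) ≤ n) {α : ℝ}
    (hα0 : α ≠ 0) (hα : |α| ≤ 1 / 2) (hc : u = 1 ∨ Real.pi ^ 2 * α ^ 2 * u ≤ 1 / 6) :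
    ∑ a ∈ faceSeqs n, ∏ b ∈ Finset.range K, blockFactor α u b a ≤
      ∑ a ∈ faceSeqs n, ∏ b ∈ Finset.range K, blockBound u b a := by
  have key : ∀ k ≤ K, ∑ a ∈ faceSeqs n, ∏ b ∈ Finset.range K, blockFactor α u b a ≤
      ∑ a ∈ faceSeqs n, (∏ b ∈ Finset.range k, blockBound u b a) *
        ∏ b ∈ Finset.Ico k K, blockFactor α u b a := by
    intro k hk
    induction k with
    | zero => simp
    | succ k ih =>
      refine (ih (by omega)).trans ?_
      have h := sum_mul_le_of_expect_le (swap_involutive u k) (swap_mem hK (by omega))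
        (P := fun a => (∏ b ∈ Finset.range k, blockBound u b a) *
          ∏ b ∈ Finset.Ico (k + 1) K, blockFactor α u b a)
        (F := blockFactor α u k) (G := blockBound u k)
        (fun a => mul_nonneg (Finset.prod_nonneg fun b _ => blockBound_nonneg u b a)
          (Finset.prod_nonneg fun b _ => blockFactor_nonneg α u b a))
        (fun ε a => by
          congr 1
          · simp only [blockBound, tokens_applyCoins]
          · refine Finset.prod_congr rfl fun b hb => ?_
            rw [Finset.mem_Ico] at hb
            rw [blockFactor, blockDefect_applyCoins_of_ne α (by omega), blockFactor])
        (fun a => expect_blockFactor_le hu hα0 hα hc k a)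
      refine (le_of_eq ?_).trans (h.trans (le_of_eq ?_))
      · refine Finset.sum_congr rfl fun a _ => ?_
        rw [Finset.prod_eq_prod_Ico_succ_bot (by omega : k < K)]
        ring
      · refine Finset.sum_congr rfl fun a _ => ?_
        rw [Finset.prod_range_succ]
        ring
  simpa using key K le_rfl

/-! ### Occupation of the cells -/

/-- The weight `2 ^ (-m)` where `m` is the number of blocks of `S` whose cells contain `v`. -/
def cellWeight (u : ℕ) (S : Finset ℕ) (v : ℕ) : ℝ :=
  ∏ b ∈ S, if InCells u b v then (1 / 2 : ℝ) else 1

theorem card_inCells {n u K b : ℕ} (hK : 6 * (u * K) ≤ n) (hb : b < K) :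
    ((Finset.Icc 1 n).filter (InCells u b)).card = 2 * u := by
  have h := mul_add_le_of_lt (u := u) hb
  have : (Finset.Icc 1 n).filter (InCells u b) =
      Finset.Ico (6 * (u * b) + 1 + 3 * u) (6 * (u * b) + 1 + 4 * u) ∪
        Finset.Ico (6 * (u * b) + 1 + 5 * u) (6 * (u * b) + 1 + 6 * u) := by
    ext v
    simp only [Finset.mem_filter, Finset.mem_Icc, InCells, Finset.mem_union, Finset.mem_Ico]
    omega
  rw [this, Finset.card_union_of_disjoint, Nat.card_Ico, Nat.card_Ico]
  · omega
  · rw [Finset.disjoint_left]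
    intro v
    simp only [Finset.mem_Ico]
    omega

theorem sum_cellWeight {n u K : ℕ} (hK : 6 * (u * K) ≤ n) {S : Finset ℕ}
    (hS : S ⊆ Finset.range K) : ∑ v ∈ Finset.Icc 1 n, cellWeight u S v = n - u * S.card := by
  induction S using Finset.induction_on with
  | empty => simp [cellWeight]
  | insert b S hb ih =>
    have hbK : b < K := Finset.mem_range.1 (hS (Finset.mem_insert_self _ _))
    have h : ∀ v, cellWeight u (insert b S) v =
        cellWeight u S v - 1 / 2 * (if InCells u b v then (1 : ℝ) else 0) := by
      intro v
      unfold cellWeight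
      rw [Finset.prod_insert hb]
      split_ifs with hv
      · rw [Finset.prod_eq_one]
        · norm_num
        · intro c hc
          rw [if_neg]
          intro hvc
          exact hb (hv.eq hvc ▸ hc)
      · ring
    simp only [h, Finset.sum_sub_distrib, ← Finset.mul_sum, Finset.sum_boole, card_inCells hK hbK,
      ih ((Finset.subset_insert _ _).trans hS), Finset.card_insert_of_notMem hb]
    push_cast
    ring

/-- The sum factors over positions into `(n - u * |S|) ^ n`, since each block of `S` halves the
weight of `2 * u` faces. -/
theorem sum_prod_half_pow_le {n u K : ℕ} (hn : 0 < n) (hK : 6 * (u * K) ≤ n) {S : Finset ℕ}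
    (hS : S ⊆ Finset.range K) :
    ∑ a ∈ faceSeqs n, ∏ b ∈ S, (1 / 2 : ℝ) ^ (tokens u b a).card ≤
      (n : ℝ) ^ n * Real.exp (-u) ^ S.card := by
  have hn' : (n : ℝ) ≠ 0 := by exact_mod_cast hn.ne'
  have h1 : ∀ a : Fin n → ℕ, ∏ b ∈ S, (1 / 2 : ℝ) ^ (tokens u b a).card =
      ∏ i, cellWeight u S (a i) := by
    intro a
    simp only [cellWeight]
    rw [Finset.prod_comm]
    refine Finset.prod_congr rfl fun b _ => ?_
    rw [tokens, Finset.prod_ite, Finset.prod_const, Finset.prod_const_one, mul_one]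
  simp only [h1, faceSeqs]
  rw [Finset.sum_prod_piFinset, Finset.prod_const, sum_cellWeight hK hS, Finset.card_univ,
    Fintype.card_fin]
  have h0 : 0 ≤ (n : ℝ) - u * S.card := by
    rw [← sum_cellWeight hK hS]
    refine Finset.sum_nonneg fun v _ => Finset.prod_nonneg fun b _ => ?_
    split_ifs <;> norm_num
  have h2 : (n : ℝ) - u * S.card ≤ n * Real.exp (-(u * S.card / n)) := by
    have h := Real.add_one_le_exp (-((u : ℝ) * S.card / n))
    calc (n : ℝ) - u * S.card = n * (-((u : ℝ) * S.card / n) + 1) := by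
          field_simp
          ring
      _ ≤ _ := mul_le_mul_of_nonneg_left h (Nat.cast_nonneg _)
  refine (pow_le_pow_left₀ h0 h2 n).trans (le_of_eq ?_)
  rw [mul_pow, ← Real.exp_nat_mul, ← Real.exp_nat_mul]
  congr 2
  field_simp

theorem blockBound_le {n : ℕ} (u b : ℕ) (a : Fin n → ℕ) :
    blockBound u b a ≤ 2 ^ u / 96 * (1 / 2 : ℝ) ^ (tokens u b a).card + 95 / 96 := by
  unfold blockBound
  split_ifs with h
  · have : (0 : ℝ) ≤ 2 ^ u / 96 * (1 / 2 : ℝ) ^ (tokens u b a).card := by positivity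
    linarith
  · have h1 : (1 / 2 : ℝ) ^ u ≤ (1 / 2 : ℝ) ^ (tokens u b a).card :=
      pow_le_pow_of_le_one (by norm_num) (by norm_num) (by omega)
    have h2 : (2 : ℝ) ^ u * (1 / 2) ^ u = 1 := by
      rw [← mul_pow]
      norm_num
    have h3 := mul_le_mul_of_nonneg_left h1 (show (0 : ℝ) ≤ 2 ^ u by positivity)
    linarith

/-- Chernoff bound for the token counts. Expanding the product over subsets `S` avoids any need for
independence of the blocks; the resulting factor per block is at most `(3/4) / 96 + 95/96 = 1 -
1/384`. -/
theorem sum_prod_blockBound_le {n u K : ℕ} (hn : 0 < n) (hu : 0 < u) (hK : 6 * (u * K) ≤ n) :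
    ∑ a ∈ faceSeqs n, ∏ b ∈ Finset.range K, blockBound u b a ≤
      (n : ℝ) ^ n * Real.exp (-(K / 384)) := by
  have h1 : ∑ a ∈ faceSeqs n, ∏ b ∈ Finset.range K, blockBound u b a ≤
      ∑ a ∈ faceSeqs n, ∏ b ∈ Finset.range K,
        (2 ^ u / 96 * (1 / 2 : ℝ) ^ (tokens u b a).card + 95 / 96) :=
    Finset.sum_le_sum fun a _ => Finset.prod_le_prod (fun b _ => blockBound_nonneg u b a)
      fun b _ => blockBound_le u b a
  refine h1.trans ?_
  simp only [Finset.prod_add, Finset.prod_mul_distrib]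
  rw [Finset.sum_comm]
  have h2 : ∀ S ∈ (Finset.range K).powerset,
      ∑ a ∈ faceSeqs n, (∏ _b ∈ S, (2 ^ u / 96 : ℝ)) *
        (∏ b ∈ S, (1 / 2 : ℝ) ^ (tokens u b a).card) * ∏ _b ∈ Finset.range K \ S, (95 / 96 : ℝ) ≤
      (n : ℝ) ^ n * ((∏ _b ∈ S, (2 ^ u / 96 * Real.exp (-u) : ℝ)) *
        ∏ _b ∈ Finset.range K \ S, (95 / 96 : ℝ)) := by
    intro S hS
    rw [← Finset.sum_mul, ← Finset.mul_sum, ← mul_assoc]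
    refine mul_le_mul_of_nonneg_right ?_ (Finset.prod_nonneg fun _ _ => by norm_num)
    have h := sum_prod_half_pow_le hn hK (Finset.mem_powerset.1 hS)
    have h' := mul_le_mul_of_nonneg_left h
      (Finset.prod_nonneg (s := S) fun _ _ => (by positivity : (0 : ℝ) ≤ 2 ^ u / 96))
    refine h'.trans (le_of_eq ?_)
    simp only [Finset.prod_const, mul_pow]
    ring
  refine (Finset.sum_le_sum h2).trans ?_
  rw [← Finset.mul_sum, ← Finset.prod_add, Finset.prod_const, Finset.card_range]
  refine mul_le_mul_of_nonneg_left ?_ (by positivity)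
  have h3 : 2 * Real.exp (-1) ≤ 3 / 4 := by
    rw [Real.exp_neg, ← div_eq_mul_inv, div_le_iff₀ (Real.exp_pos _)]
    linarith [Real.exp_one_gt_d9]
  have h4 : (2 : ℝ) ^ u * Real.exp (-u) ≤ 3 / 4 := by
    have h : (2 : ℝ) ^ u * Real.exp (-u) = (2 * Real.exp (-1)) ^ u := by
      rw [mul_pow, ← Real.exp_nat_mul, mul_neg_one]
    rw [h]
    exact (pow_le_of_le_one (by positivity) (by linarith) hu.ne').trans h3
  have h5 : (2 : ℝ) ^ u / 96 * Real.exp (-u) + 95 / 96 ≤ Real.exp (-(1 / 384)) := by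
    have := Real.add_one_le_exp (-(1 / 384 : ℝ))
    linarith
  refine (pow_le_pow_left₀ (by positivity) h5 K).trans (le_of_eq ?_)
  rw [← Real.exp_nat_mul]
  congr 1
  ring

/-! ### The law of a random die -/

theorem le_randomDie_real {n : ℕ} (hn : 0 < n) {G : Set (Fin n → ℕ)} {B : Finset (Fin n → ℕ)}
    (hB : ∀ A ∈ dice n, A ∉ G → A ∈ B) {q : ℝ} (hq : (B.card : ℝ) ≤ (n : ℝ) ^ n * q) :
    1 - (n : ℝ) ^ 2 * q ≤ (randomDie n).real G := by
  have hn' : (0 : ℝ) < n := by exact_mod_cast hn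
  have h1 : 1 ≤ (randomDie n).real G + (randomDie n).real Gᶜ := by
    have h := MeasureTheory.measureReal_union_le (μ := randomDie n) G Gᶜ
    rwa [Set.union_compl_self, MeasureTheory.probReal_univ] at h
  have hdf := dice_finite n
  have hinter : (dice n ∩ Gᶜ).Finite := hdf.subset Set.inter_subset_left
  have h2 : (randomDie n).real Gᶜ = ((dice n).ncard : ℝ)⁻¹ * (dice n ∩ Gᶜ).ncard := by
    rw [MeasureTheory.measureReal_def, randomDie, ProbabilityTheory.uniformOn,
      ProbabilityTheory.cond_apply hdf.measurableSet,
      MeasureTheory.Measure.count_apply_finite _ hdf,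
      MeasureTheory.Measure.count_apply_finite _ hinter, ENNReal.toReal_mul, ENNReal.toReal_inv,
      ENNReal.toReal_natCast, ENNReal.toReal_natCast, Set.ncard_eq_toFinset_card _ hdf,
      Set.ncard_eq_toFinset_card _ hinter]
  have h3 : ((dice n ∩ Gᶜ).ncard : ℝ) ≤ B.card := by
    have h : (dice n ∩ Gᶜ).ncard ≤ (B : Set (Fin n → ℕ)).ncard :=
      Set.ncard_le_ncard (fun A hA => hB A hA.1 hA.2) B.finite_toSet
    rw [Set.ncard_coe_finset] at h
    exact_mod_cast h
  have h4 : (n : ℝ) ^ n ≤ n * n * (dice n).ncard := by exact_mod_cast pow_le_card_dice hn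
  have hpow : (0 : ℝ) < (n : ℝ) ^ n := by positivity
  have hd : (0 : ℝ) < (dice n).ncard := by
    by_contra h
    have : ((dice n).ncard : ℝ) = 0 := le_antisymm (not_lt.1 h) (Nat.cast_nonneg _)
    rw [this, mul_zero] at h4
    linarith
  have hq0 : 0 ≤ q := by
    by_contra h
    have := mul_neg_of_pos_of_neg hpow (not_le.1 h)
    linarith [(Nat.cast_nonneg B.card : (0 : ℝ) ≤ _)]
  have h5 : (randomDie n).real Gᶜ ≤ (n : ℝ) ^ 2 * q := by
    rw [h2, inv_mul_le_iff₀ hd]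
    calc _ ≤ (n : ℝ) ^ n * q := h3.trans hq
      _ ≤ n * n * (dice n).ncard * q := mul_le_mul_of_nonneg_right h4 hq0
      _ = _ := by ring
  linarith

/-- Markov's inequality for the exponential moment, spending half of the exponent `K / 384`. -/
theorem card_small_defect_le {n u K : ℕ} (hn : 0 < n) (hu : 0 < u) (hK : 6 * (u * K) ≤ n)
    {α : ℝ} (hα0 : α ≠ 0) (hα : |α| ≤ 1 / 2)
    (hc : u = 1 ∨ Real.pi ^ 2 * α ^ 2 * u ≤ 1 / 6) :
    (((faceSeqs n).filter fun a => rate α u / u * ∑ b ∈ Finset.range K, blockDefect α u b a <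
      K / 768).card : ℝ) ≤ (n : ℝ) ^ n * Real.exp (-(K / 768)) := by
  set B := (faceSeqs n).filter fun a => rate α u / u * ∑ b ∈ Finset.range K, blockDefect α u b a <
      K / 768 with hB
  have h1 := (sum_prod_blockFactor_le hu hK hα0 hα hc).trans (sum_prod_blockBound_le hn hu hK)
  have h2 : (B.card : ℝ) * Real.exp (-(K / 768)) ≤
      ∑ a ∈ faceSeqs n, ∏ b ∈ Finset.range K, blockFactor α u b a := by
    rw [← nsmul_eq_mul, ← Finset.sum_const]
    refine le_trans (Finset.sum_le_sum fun a ha => ?_) (Finset.sum_le_sum_of_subset_of_nonneg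
      (Finset.filter_subset _ _) fun a _ _ =>
        Finset.prod_nonneg fun b _ => blockFactor_nonneg α u b a)
    simp only [blockFactor]
    rw [← Real.exp_sum, Finset.sum_neg_distrib, ← Finset.mul_sum]
    exact Real.exp_le_exp.2 (neg_le_neg (Finset.mem_filter.1 ha).2.le)
  have h3 : Real.exp (-((K : ℝ) / 384)) = Real.exp (-(K / 768)) * Real.exp (-(K / 768)) := by
    rw [← Real.exp_add]
    congr 1
    ring
  rw [h3, ← mul_assoc] at h1
  exact le_of_mul_le_mul_right (h2.trans h1) (Real.exp_pos _)

theorem prob_norm_fHat_le {n u : ℕ} (hn : 0 < n) (hu : 0 < u) {α : ℝ} (hα0 : α ≠ 0)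
    (hα : |α| ≤ 1 / 2) (hc : u = 1 ∨ Real.pi ^ 2 * α ^ 2 * u ≤ 1 / 6) (hun : 6 * u ≤ n)
    (hlog : 110592 * (u * Real.log n) ≤ n) :
    1 - (n : ℝ) ^ (-10 : ℤ) ≤
      (randomDie n).real {A : Fin n → ℕ | ∀ β : ℝ, ‖fHat A α β‖ ≤ 1 - α ^ 2 * u / 1000} := by
  have hn' : (0 : ℝ) < n := by exact_mod_cast hn
  have hu' : (0 : ℝ) < u := by exact_mod_cast hu
  have hα2 : 0 < α ^ 2 := by positivity
  set K := n / (6 * u) with hKdef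
  have hK : 6 * (u * K) ≤ n := by
    rw [← mul_assoc]
    exact Nat.mul_div_le n (6 * u)
  have hK2 : (n : ℝ) ≤ 12 * (u * K) := by
    have h1 : n < 6 * u * (K + 1) := Nat.lt_mul_div_succ n (by omega)
    have h2 : 1 ≤ K := (Nat.one_le_div_iff (by omega)).2 hun
    have h3 : n ≤ 12 * (u * K) := by nlinarith
    exact_mod_cast h3
  -- Here `110592 = 12 * 12 * 768`: one 12 from `n ≤ 12 * (u * K)`, the other from the target `n ^
  -- (-12)`.
  have hKlog : 12 * Real.log n ≤ K / 768 := by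
    have : (u : ℝ) * (110592 * Real.log n) ≤ u * (12 * K) := by linarith
    have := le_of_mul_le_mul_left this hu'
    linarith
  have hexp : Real.exp (-((K : ℝ) / 768)) ≤ (n : ℝ) ^ (-12 : ℤ) := by
    have h : (n : ℝ) ^ (-12 : ℤ) = Real.exp (-(12 * Real.log n)) := by
      rw [zpow_neg, Real.exp_neg, show (12 : ℤ) = ((12 : ℕ) : ℤ) from rfl, zpow_natCast,
        show (12 : ℝ) * Real.log n = ((12 : ℕ) : ℝ) * Real.log n by norm_num, Real.exp_nat_mul,
        Real.exp_log hn']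
    rw [h]
    exact Real.exp_le_exp.2 (neg_le_neg hKlog)
  have hcard := card_small_defect_le hn hu hK hα0 hα hc
  have hq := hcard.trans (mul_le_mul_of_nonneg_left hexp (by positivity))
  have hpow : (n : ℝ) ^ 2 * (n : ℝ) ^ (-12 : ℤ) = (n : ℝ) ^ (-10 : ℤ) := by
    rw [← zpow_natCast, ← zpow_add₀ hn'.ne']
    norm_num
  rw [← hpow]
  refine le_randomDie_real hn (fun A hA hAG => ?_) hq
  by_contra hAB
  refine hAG fun β => ?_
  have hAmem : A ∈ faceSeqs n := by
    rw [faceSeqs, Fintype.mem_piFinset]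
    exact fun i => Finset.mem_Icc.2 (hA.1 i)
  have h1 : (K : ℝ) / 768 ≤ rate α u / u * ∑ b ∈ Finset.range K, blockDefect α u b A := by
    by_contra h
    exact hAB (Finset.mem_filter.2 ⟨hAmem, not_le.1 h⟩)
  have h2 := sum_blockDefect_le hn hK A α β
  have h3 := h1.trans (mul_le_mul_of_nonneg_left h2 (div_nonneg (rate_nonneg α u) hu'.le))
  -- `9.216 = 12 * 768 / 1000` produces the constant `1 / 1000`.
  have hpi : (9.216 : ℝ) ≤ Real.pi ^ 2 := by nlinarith [Real.pi_gt_d2]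
  have h4 : rate α u / u * (12 * (n * (1 - ‖fHat A α β‖))) =
      n * (1 - ‖fHat A α β‖) / (Real.pi ^ 2 * α ^ 2 * u ^ 2) := by
    rw [rate]
    field_simp
  rw [h4, le_div_iff₀ (by positivity)] at h3
  have h5 : (n : ℝ) * (α ^ 2 * u / 1000) ≤ n * (1 - ‖fHat A α β‖) := by
    refine le_trans ?_ h3
    calc (n : ℝ) * (α ^ 2 * u / 1000) ≤ 12 * (u * K) * (α ^ 2 * u / 1000) := by gcongr
      _ = K / 768 * (9.216 * α ^ 2 * u ^ 2) := by ring
      _ ≤ _ := by gcongr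
  have h6 := le_of_mul_le_mul_left h5 hn'
  linarith

theorem norm_fHat_le_one {n : ℕ} (hn : 0 < n) (A : Fin n → ℕ) (α β : ℝ) : ‖fHat A α β‖ ≤ 1 := by
  -- With no blocks the defect inequality reads `0 ≤ 12 * (n * (1 - ‖fHat A α β‖))`.
  have h := sum_blockDefect_le (K := 0) (u := 0) hn (by simp) A α β
  rw [Finset.range_zero, Finset.sum_empty] at h
  have hn' : (0 : ℝ) < n := by exact_mod_cast hn
  nlinarith

end IntransitiveDice

end
-- Choice of the block scale `u`
theorem mainTheorem6 :
    ∃ N : ℕ, ∀ n : ℕ, N ≤ n → ∀ α : ℝ, |α| ≤ 1 / 2 →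
      1 - (n : ℝ) ^ (-10 : ℤ) ≤
        (IntransitiveDice.randomDie n).real
          {A : Fin n → ℕ | ∀ β : ℝ,
            ‖IntransitiveDice.fHat A α β‖ ≤ 1 - IntransitiveDice.delta n α} := by
  have hev : ∀ᶠ n : ℕ in Filter.atTop, 110592 * Real.log (n : ℝ) ≤ n ∧ 3 ≤ n := by
    refine Filter.Eventually.and ?_ (Filter.eventually_ge_atTop 3)
    have h := (Real.isLittleO_log_id_atTop.comp_tendsto tendsto_natCast_atTop_atTop).bound
      (show (0 : ℝ) < 1 / 110592 by norm_num)
    filter_upwards [h] with n hn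
    simp only [Function.comp, id, Real.norm_eq_abs, Nat.abs_cast] at hn
    linarith [le_abs_self (Real.log (n : ℝ))]
  obtain ⟨N, hN⟩ := Filter.eventually_atTop.1 hev
  refine ⟨N, fun n hn α hα => ?_⟩
  obtain ⟨hlog, hn3⟩ := hN n hn
  have hn0 : 0 < n := by omega
  have hn' : (0 : ℝ) < n := by exact_mod_cast hn0
  have hlog1 : 1 ≤ Real.log n := by
    rw [Real.le_log_iff_exp_le hn']
    have : (3 : ℝ) ≤ n := by exact_mod_cast hn3
    linarith [Real.exp_one_lt_d9]
  have hlog0 : 0 < Real.log n := by linarith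
  rcases eq_or_ne α 0 with rfl | hα0
  · have : {A : Fin n → ℕ | ∀ β : ℝ,
        ‖IntransitiveDice.fHat A 0 β‖ ≤ 1 - IntransitiveDice.delta n 0} = Set.univ := by
      refine Set.eq_univ_of_forall fun A β => ?_
      have : IntransitiveDice.delta n 0 = 0 := by simp [IntransitiveDice.delta]
      rw [this, sub_zero]
      exact IntransitiveDice.norm_fHat_le_one hn0 A 0 β
    rw [this, MeasureTheory.probReal_univ]
    have : (0 : ℝ) ≤ (n : ℝ) ^ (-10 : ℤ) := by positivity
    linarith
  have hα2 : 0 < α ^ 2 := by positivity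
  obtain ⟨u, hu, hc, hul, hδ⟩ : ∃ u : ℕ, 0 < u ∧
      (u = 1 ∨ Real.pi ^ 2 * α ^ 2 * u ≤ 1 / 6) ∧ 110592 * (u * Real.log n) ≤ n ∧
      IntransitiveDice.delta n α ≤ α ^ 2 * u / 1000 := by
    have hpi := IntransitiveDice.pi_sq_le_ten
    have hpi0 := Real.pi_pos
    -- `x` is the largest scale allowed by the moment bound, `y` the largest leaving enough blocks
    -- for the probability. Take `u = ⌊min x y⌋₊`, or `u = 1` if `x < 1`. Flooring loses at most a
    -- factor 2; the minimum at `x` gives the constant term of `delta`, the minimum at `y` the term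
    -- in `α ^ 2 * n / log n`.
    set x := 1 / (6 * (Real.pi ^ 2 * α ^ 2)) with hx
    set y := (n : ℝ) / (110592 * Real.log n) with hy
    have hx60 : 1 / 60 ≤ α ^ 2 * x := by
      rw [hx, mul_one_div, div_le_div_iff₀ (by norm_num) (by positivity)]
      nlinarith
    have hy1 : 1 ≤ y := by
      rw [hy, one_le_div (by positivity)]
      exact hlog
    have hδ1 : IntransitiveDice.delta n α ≤ (10 : ℝ) ^ (-13 : ℤ) := min_le_left _ _
    have hδ2 : IntransitiveDice.delta n α ≤
        (10 : ℝ) ^ (-11 : ℤ) * (α ^ 2 * (n : ℝ) / Real.log (n : ℝ)) := min_le_right _ _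
    rcases lt_or_ge x 1 with hx1 | hx1
    · refine ⟨1, one_pos, Or.inl rfl, by simpa using hlog, hδ1.trans ?_⟩
      have : 1 / 60 ≤ α ^ 2 := by nlinarith
      norm_num
      linarith
    · have hm1 : 1 ≤ min x y := le_min hx1 hy1
      have hu1 : 1 ≤ ⌊min x y⌋₊ := Nat.one_le_floor_iff _ |>.2 hm1
      have hle : (⌊min x y⌋₊ : ℝ) ≤ min x y := Nat.floor_le (by linarith)
      have hge : min x y ≤ 2 * (⌊min x y⌋₊ : ℝ) := by
        have h1 := Nat.lt_floor_add_one (min x y)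
        have h2 : (1 : ℝ) ≤ ⌊min x y⌋₊ := by exact_mod_cast hu1
        linarith
      generalize ⌊min x y⌋₊ = u at *
      refine ⟨u, hu1, Or.inr ?_, ?_, ?_⟩
      · have h := hle.trans (min_le_left _ _)
        rw [hx, le_div_iff₀ (by positivity)] at h
        linarith
      · have h := hle.trans (min_le_right _ _)
        rw [hy, le_div_iff₀ (by positivity)] at h
        linarith
      · rcases min_choice x y with h | h <;> rw [h] at hge
        · refine hδ1.trans ?_
          have := mul_le_mul_of_nonneg_left hge hα2.le
          norm_num
          linarith
        · refine hδ2.trans ?_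
          have h1 : α ^ 2 * (n : ℝ) / Real.log n = 110592 * (α ^ 2 * y) := by
            rw [hy]
            field_simp
          have h2 := mul_le_mul_of_nonneg_left hge hα2.le
          have h3 : 0 ≤ α ^ 2 * y := by positivity
          rw [h1]
          norm_num
          linarith
  have hun : 6 * u ≤ n := by
    have h1 : (u : ℝ) * 1 ≤ u * Real.log n := mul_le_mul_of_nonneg_left hlog1 (Nat.cast_nonneg _)
    have h2 : (6 : ℝ) * u ≤ n := by
      have : (0 : ℝ) ≤ u := Nat.cast_nonneg _
      linarith
    exact_mod_cast h2
  refine (IntransitiveDice.prob_norm_fHat_le hn0 hu hα0 hα hc hun hul).trans ?_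
  refine MeasureTheory.measureReal_mono fun A hA β => ?_
  exact (hA β).trans (by linarith)
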